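/- For $u,v\in\mathbb{Z}$ let $g_{u,v}\in\mathbb{Q}((z^{-1}))$ be the Laurent series $$g_{u,v}(z)=z^{-1}\prod_{t=0}^{\infty}\bigl(1+u\,z^{-3^t}+v\,z^{-2\cdot 3^t}\bigr).$$ Write its continued fraction as $[a_0(z),a_1(z),a_2(z),\ldots]$, with polynomials $a_k\in\mathbb{Q}[z]$ of degree at least $1$ for $k\ge 1$, and let $d_k$ be the degree of the denominator $q_k$ of its $k$-th convergent ($q_0=1$, $q_1=a_1$, $q_k=a_kq_{k-1}+q_{k-2}$). Let $p\ge 3$ be a prime and suppose that $(u,v)\in\mathbb{Z}^2$ satisfies at least one of the following conditions, where $\varphi,\delta$ denote integers and all congruences are modulo $p$: 1. $u^2\equiv 3$ and $v\equiv 1$; 2. $u^2\equiv -3$ and $v\equiv -1$; 3. $u\equiv\pm\varphi$ and $v\equiv 0$, for some $\varphi$ with $\varphi^2+\varphi+1\equiv 0$; 4. $u\equiv\pm\varphi$ and $v\equiv -1$, for some $\varphi$ with $\varphi^4+4\varphi^2+1\equiv 0$; 5. $u\equiv\pm\varphi$ and $v\equiv\delta$, for some $\varphi,\delta$ with $\delta^2-\delta+1\equiv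 0$ and $\varphi^2\equiv 2\delta$; 6. $u\equiv 0$ and $v\equiv\pm\delta$, for some $\delta$ with $\delta^2+\delta+1\equiv 0$; 7. $p\ne 3$, $u\equiv\pm 2\delta^2$ and $v\equiv\delta$, for some $\delta$ with $\delta^2+\delta+1\equiv 0$. Then the continued fraction of $g_{u,v}$ is infinite and all its partial quotients $a_k$ with $k\ge 1$ are linear, that is, $\deg a_k=1$ for all $k\ge 1$. Equivalently, $d_k=k$ for all $k\ge 0$. In particular $g_{u,v}$ is badly approximable: its continued fraction is infinite and the degrees of its partial quotients are bounded. -/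

import Mathlib

open Polynomial

noncomputable section

namespace LaurentCF

variable {F : Type*} [Field F]

/-- The embedding `F[z] → F((z⁻¹))`.  A Laurent series in `z⁻¹` is an element of Mathlib's
`LaurentSeries F` whose variable stands for `z⁻¹`; so `z` is `HahnSeries.single (-1) 1`, and the
coefficient of `z ^ (-n)` in `f` is `f.coeff n`. -/
def ofPoly : F[X] →+* LaurentSeries F :=
  Polynomial.eval₂RingHom HahnSeries.C (HahnSeries.single (-1 : ℤ) (1 : F))

/-- The polynomial part of a Laurent series in `z⁻¹`. -/
def polyPart (f : LaurentSeries F) : F[X] :=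
  ∑ i ∈ Finset.range ((-f.order).toNat + 1), Polynomial.monomial i (f.coeff (-(i : ℤ)))

theorem coeff_polyPart (f : LaurentSeries F) (i : ℕ) :
    (polyPart f).coeff i = f.coeff (-(i : ℤ)) := by
  simp only [polyPart, Polynomial.finsetSum_coeff, Polynomial.coeff_monomial,
    Finset.sum_ite_eq', Finset.mem_range]
  split_ifs with h
  · rfl
  · exact (HahnSeries.coeff_eq_zero_of_lt_order (by omega)).symm

/-- The complete quotients of the continued fraction algorithm:
`f₀ = f` and `fₙ₊₁ = 1 / (fₙ - polyPart fₙ)`.  If `fₙ` is a polynomial then the expansion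
ends at `n`, and all later complete quotients take the value `0`. -/
def completeQuotient (f : LaurentSeries F) : ℕ → LaurentSeries F
  | 0 => f
  | n + 1 => (completeQuotient f n - ofPoly (polyPart (completeQuotient f n)))⁻¹

/-- The partial quotients `aₙ` of the continued fraction
`f = [a₀, a₁, a₂, …] = a₀ + 1 / (a₁ + 1 / (a₂ + ⋯))`.  For `n ≥ 1` an actual partial quotient has
degree at least one, and the value `0` means that the expansion has ended before `n`. -/
def partialQuotient (f : LaurentSeries F) (n : ℕ) : F[X] :=
  polyPart (completeQuotient f n)

/-- The denominator `qₙ` of the `n`-th convergent `[a₀, …, aₙ]`.  (Normalising the partial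
quotients to be monic multiplies `qₙ` by a non-zero constant and does not change its degree.) -/
def convDenom (f : LaurentSeries F) : ℕ → F[X]
  | 0 => 1
  | 1 => partialQuotient f 1
  | n + 2 => partialQuotient f (n + 2) * convDenom f (n + 1) + convDenom f n

/-- `f` is badly approximable: its continued fraction does not end, and the degrees of its partial
quotients are bounded. -/
def BadlyApproximable (f : LaurentSeries F) : Prop :=
  ∃ M : ℕ, ∀ k : ℕ, 1 ≤ k → partialQuotient f k ≠ 0 ∧ (partialQuotient f k).natDegree ≤ M

/-- The partial product `∏_{t < N} (1 + u x^{3^t} + v x^{2·3^t})`, with `x = z⁻¹`. -/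
def partialProd (u v : F) (N : ℕ) : PowerSeries F :=
  ∏ t ∈ Finset.range N,
    (1 + PowerSeries.C u * PowerSeries.X ^ (3 ^ t) + PowerSeries.C v * PowerSeries.X ^ (2 * 3 ^ t))

/-- The infinite product `∏_{t ≥ 0} (1 + u x^{3^t} + v x^{2·3^t})`, i.e. the coefficientwise limit
of the partial products: by `coeff_partialProd` below, the coefficient of `x ^ n` is the same in all
partial products with at least `n` factors. -/
def infProd (u v : F) : PowerSeries F :=
  PowerSeries.mk fun n => PowerSeries.coeff n (partialProd u v n)

theorem coeff_partialProd (u v : F) {n N : ℕ} (h : n ≤ N) :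
    PowerSeries.coeff n (partialProd u v N) = PowerSeries.coeff n (infProd u v) := by
  rw [infProd, PowerSeries.coeff_mk]
  induction N, h using Nat.le_induction with
  | base => rfl
  | succ N h ih =>
    have h3 : n < 3 ^ N := lt_of_le_of_lt h (Nat.lt_pow_self (by norm_num))
    have h6 : n < 2 * 3 ^ N := by omega
    rw [← ih, partialProd, Finset.prod_range_succ, ← partialProd, mul_add, mul_add, mul_one,
      ← mul_assoc, ← mul_assoc]
    simp [PowerSeries.coeff_mul_X_pow', Nat.not_le.mpr h3, Nat.not_le.mpr h6]

/-- The series `g_{u,v}(z) = z⁻¹ ∏_{t ≥ 0} (1 + u z^{-3^t} + v z^{-2·3^t})`. -/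
def gSeries (u v : F) : LaurentSeries F :=
  HahnSeries.single (1 : ℤ) (1 : F) * HahnSeries.ofPowerSeries ℤ F (infProd u v)

end LaurentCF

end

noncomputable section

namespace LaurentCF


/-! The series satisfies `g(z) = (z² + u z + v) g(z³)`, and its partial quotients are all linear iff
no Hankel determinant of its coefficients vanishes. These determinants are integers, so it suffices
that they are nonzero modulo `p`.

Over `ZMod p` one guesses a J-fraction with denominators `q_n` such that `q_{3k}(z) = q_k(z³)`; the
relations `IsSelfSimilar` give this (`jDenom_three_mul`). Together with the functional equation they
force the functional `L` sending `X ^ i` to the `i`-th coefficient to kill every `q_n` with `n ≥ 1`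
(`momentFunctional_jDenom`). Hence the `q_n` are orthogonal for `L`, and since the `b n` with `n ≥
1` are nonzero, the Hankel forms are nondegenerate.

The infinitely many relations are solved by sequences recursive in the base 3 digits of the index,
which leaves the finite system `IsParameter` in `s, t, x, y`. Each congruence condition supplies a
solution. -/

/-- The denominators of the J-fraction with coefficients `a` and `b`. -/
def jDenom {F : Type*} [Field F] (a b : ℕ → F) : ℕ → F[X]
  | 0 => 1
  | 1 => X + C (a 0)
  | n + 2 => (X + C (a (n + 1))) * jDenom a b (n + 1) + C (b (n + 1)) * jDenom a b n

/-- The linear functional on polynomials that takes the value `f i` at `X ^ i`. -/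
def momentFunctional {F : Type*} [Field F] (f : ℕ → F) : F[X] →ₗ[F] F :=
  Polynomial.lsum fun i => f i • LinearMap.id

/-- The algebraic relations on the coefficients of a J-fraction that express that the J-fraction
is invariant under `g(z) ↦ (z² + u z + v) g(z³)`. -/
structure IsSelfSimilar {F : Type*} [Field F] (u v : F) (a b : ℕ → F) : Prop where
  a_zero : ∀ k, a (3 * k) = -u
  a_add : ∀ k, a (3 * k + 1) + a (3 * k + 2) = u
  b_two : ∀ k, b (3 * k + 2) = v - a (3 * k + 1) * a (3 * k + 2)
  b_zero : b 0 = 0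
  b_add : ∀ k, b (3 * k) + b (3 * k + 1) = u ^ 2 - v
  b_mul : ∀ k, b (3 * k + 3) * b (3 * k + 2) * b (3 * k + 1) = b (k + 1)
  base : b 1 * a 2 = a 0 + u * v
  step : ∀ k, b (3 * k + 4) * a (3 * k + 5) + b (3 * k + 3) * a (3 * k + 1) = a (k + 1) + u * v
  b_ne_zero : ∀ n, b (n + 1) ≠ 0

/-! ### Moment functionals and J-fraction denominators. -/

section Functional

variable {F : Type*} [Field F]

theorem momentFunctional_monomial (f : ℕ → F) (n : ℕ) (c : F) :
    momentFunctional f (monomial n c) = f n * c := by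
  simp [momentFunctional, Polynomial.lsum_apply, Polynomial.sum_monomial_index]

theorem momentFunctional_C_mul (f : ℕ → F) (c : F) (h : F[X]) :
    momentFunctional f (C c * h) = c * momentFunctional f h := by
  rw [← smul_eq_C_mul, map_smul, smul_eq_mul]

/-- By linearity only monomials matter, where this is `hf`. It is the form in which the functional
equation of the series acts on `L`. -/
theorem momentFunctional_X_pow_mul_expand (f : ℕ → F) (r : ℕ) (c : F)
    (hf : ∀ i, f (3 * i + r) = c * f i) (h : F[X]) :
    momentFunctional f (X ^ r * expand F 3 h) = c * momentFunctional f h := by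
  induction h using Polynomial.induction_on' with
  | add p q hp hq => rw [map_add, mul_add, map_add, map_add, hp, hq, mul_add]
  | monomial n d =>
    rw [expand_monomial, X_pow_mul_monomial, momentFunctional_monomial, momentFunctional_monomial,
      mul_comm n 3, hf, mul_assoc]

theorem jDenom_add_two (a b : ℕ → F) (n : ℕ) :
    jDenom a b (n + 2) =
      (X + C (a (n + 1))) * jDenom a b (n + 1) + C (b (n + 1)) * jDenom a b n := rfl

theorem jDenom_monic_natDegree (a b : ℕ → F) (n : ℕ) :
    (jDenom a b n).Monic ∧ (jDenom a b n).natDegree = n := by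
  induction n using Nat.twoStepInduction with
  | zero => exact ⟨monic_one, natDegree_one⟩
  | one => exact ⟨monic_X_add_C _, natDegree_X_add_C _⟩
  | more n h0 h1 =>
    have hm : ((X + C (a (n + 1))) * jDenom a b (n + 1)).Monic := (monic_X_add_C _).mul h1.1
    have hd : ((X + C (a (n + 1))) * jDenom a b (n + 1)).natDegree = n + 2 := by
      rw [(monic_X_add_C _).natDegree_mul h1.1, natDegree_X_add_C, h1.2]; omega
    have hlt : (C (b (n + 1)) * jDenom a b n).degree <
        ((X + C (a (n + 1))) * jDenom a b (n + 1)).degree := by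
      rw [← smul_eq_C_mul]
      refine lt_of_le_of_lt (degree_smul_le _ _) ?_
      rw [degree_eq_natDegree hm.ne_zero, degree_eq_natDegree h0.1.ne_zero, hd, h0.2]
      exact_mod_cast (by omega : n < n + 2)
    rw [jDenom_add_two]
    exact ⟨hm.add_of_left hlt, by rw [natDegree_add_eq_left_of_degree_lt hlt, hd]⟩

end Functional

/-! ### Self-similar J-fractions. -/

namespace IsSelfSimilar

variable {F : Type*} [Field F] {u v : F} {a b : ℕ → F}

theorem jDenom_three (h : IsSelfSimilar u v a b) : jDenom a b 3 = X ^ 3 + C (a 0) := by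
  have e0 := congrArg C (h.a_zero 0)
  have e1 := congrArg C (h.a_add 0)
  have e2 := congrArg C (h.b_two 0)
  have e3 := congrArg C (h.b_add 0)
  have e4 := congrArg C h.base
  have e5 := congrArg C h.b_zero
  simp only [mul_zero, zero_add, C_add, C_mul, C_sub, C_neg, C_pow, C_0] at e0 e1 e2 e3 e4 e5
  simp only [jDenom, zero_add, Nat.reduceAdd]
  linear_combination (X ^ 2 + C u * X + C v) * e0 + e4 + X * e3 - X * e5 +
    (X + C (a 0)) * (X * e1 + e2)

/-- Three steps of the recurrence contract to one step of the original recurrence with `X ^ 3` in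
place of `X`; the relations `a_add`, `b_two`, `b_add`, `b_mul`, `step` match the coefficients. -/
theorem jDenom_three_step (h : IsSelfSimilar u v a b) (k : ℕ) :
    jDenom a b (3 * k + 6) =
      (X ^ 3 + C (a (k + 1))) * jDenom a b (3 * k + 3) + C (b (k + 1)) * jDenom a b (3 * k) := by
  have e0 := congrArg C (h.a_zero (k + 1))
  have e1 := congrArg C (h.a_add k)
  have e2 := congrArg C (h.b_two k)
  have f1 := congrArg C (h.a_add (k + 1))
  have f2 := congrArg C (h.b_two (k + 1))
  have e3 := congrArg C (h.b_add (k + 1))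
  have e4 := congrArg C (h.step k)
  have e5 := congrArg C (h.b_mul k)
  simp only [mul_add, mul_one, add_assoc, Nat.reduceAdd, C_add, C_mul, C_sub, C_neg, C_pow]
    at e0 e1 e2 e3 e4 e5 f1 f2
  have r2 := jDenom_add_two a b (3 * k)
  have r3 := jDenom_add_two a b (3 * k + 1)
  have r4 := jDenom_add_two a b (3 * k + 2)
  have r5 := jDenom_add_two a b (3 * k + 3)
  have r6 := jDenom_add_two a b (3 * k + 4)
  simp only [add_assoc, Nat.reduceAdd] at r2 r3 r4 r5 r6
  generalize jDenom a b (3 * k) = q0 at *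
  generalize jDenom a b (3 * k + 1) = q1 at *
  generalize jDenom a b (3 * k + 2) = q2 at *
  generalize jDenom a b (3 * k + 3) = q3 at *
  generalize jDenom a b (3 * k + 4) = q4 at *
  generalize jDenom a b (3 * k + 5) = q5 at *
  generalize jDenom a b (3 * k + 6) = q6 at *
  generalize C (a (3 * k + 3)) = a3 at *
  generalize C (a (3 * k + 1)) = a1 at *
  generalize C (a (3 * k + 2)) = a2 at *
  generalize C (a (3 * k + 4)) = a4 at *
  generalize C (a (3 * k + 5)) = a5 at *
  generalize C (b (3 * k + 1)) = b1 at *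
  generalize C (b (3 * k + 2)) = b2 at *
  generalize C (b (3 * k + 3)) = b3 at *
  generalize C (b (3 * k + 4)) = b4 at *
  generalize C (b (3 * k + 5)) = b5 at *
  generalize C (a (k + 1)) = α at *
  generalize C (b (k + 1)) = β at *
  generalize C u = U at *
  generalize C v = V at *
  -- All coefficients are expressed through `a1, a2, a5, b1, b2, b3`, and all denominators through
  -- `q0, q1`; what remains is a polynomial identity.
  have hα : α = b4 * a5 + b3 * a1 - U * V := by linear_combination -e4
  have hU : U = a1 + a2 := e1.symm
  have hV : V = b2 + a1 * a2 := by linear_combination -e2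
  have hb4 : b4 = U ^ 2 - V - b3 := by linear_combination e3
  have ha4 : a4 = U - a5 := by linear_combination f1
  subst e0 hα
  rw [r6, r5, r4, r3, r2, f2, ← e5, ha4, hb4, hV, hU]
  ring

theorem jDenom_three_mul (h : IsSelfSimilar u v a b) (k : ℕ) :
    jDenom a b (3 * k) = expand F 3 (jDenom a b k) := by
  induction k using Nat.twoStepInduction with
  | zero => simp [jDenom]
  | one => simpa [jDenom] using h.jDenom_three
  | more k h0 h1 =>
    rw [show 3 * (k + 2) = 3 * k + 6 by ring, h.jDenom_three_step, h0,
      show 3 * k + 3 = 3 * (k + 1) by ring, h1, jDenom_add_two]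
    simp

variable {f : ℕ → F}

/-- Write `L` for the functional. Since `q_{3k}(z) = q_k(z³)`, the values of `L` at `q_{3k}`, `X
q_{3k}`, `X² q_{3k}` are `1, u, v` times `L(q_k)`. The recurrence reduces the other residues to
these and to smaller indices. -/
theorem momentFunctional_jDenom (h : IsSelfSimilar u v a b)
    (h0 : ∀ i, f (3 * i) = f i) (h1 : ∀ i, f (3 * i + 1) = u * f i)
    (h2 : ∀ i, f (3 * i + 2) = v * f i) (n : ℕ) :
    momentFunctional f (jDenom a b (n + 1)) = 0 := by
  set L := momentFunctional f with hL
  have lC (c : F) (g : F[X]) : L (C c * g) = c * L g := momentFunctional_C_mul f c g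
  have l0 (k : ℕ) : L (jDenom a b (3 * k)) = L (jDenom a b k) := by
    have := momentFunctional_X_pow_mul_expand f 0 1 (by simpa using h0) (jDenom a b k)
    rwa [pow_zero, one_mul, one_mul, ← h.jDenom_three_mul] at this
  have l1 (k : ℕ) : L (X * jDenom a b (3 * k)) = u * L (jDenom a b k) := by
    have := momentFunctional_X_pow_mul_expand f 1 u h1 (jDenom a b k)
    rwa [pow_one, ← h.jDenom_three_mul] at this
  have l2 (k : ℕ) : L (X ^ 2 * jDenom a b (3 * k)) = v * L (jDenom a b k) := by
    have := momentFunctional_X_pow_mul_expand f 2 v h2 (jDenom a b k)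
    rwa [← h.jDenom_three_mul] at this
  have q1 : jDenom a b 1 = X * jDenom a b (3 * 0) - C u * jDenom a b (3 * 0) := by
    have := h.a_zero 0
    rw [mul_zero] at this
    simp [jDenom, this, sub_eq_add_neg]
  have q2 : jDenom a b 2 = X ^ 2 * jDenom a b (3 * 0) - C u * (X * jDenom a b (3 * 0)) +
      C (a 1) * jDenom a b 1 + C (b 1) * jDenom a b (3 * 0) := by
    rw [jDenom_add_two, q1]; ring
  -- Needed because `L(q_0) ≠ 0` is possible: `L(q_2) = (v - u² + b 1) L(q_0)` must cancel.
  have hb1 : b 1 = u ^ 2 - v := by simpa [h.b_zero] using h.b_add 0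
  induction n using Nat.strong_induction_on with
  | _ n ih =>
    obtain ⟨k, rfl | rfl | rfl⟩ : ∃ k, n = 3 * k ∨ n = 3 * k + 1 ∨ n = 3 * k + 2 :=
      ⟨n / 3, by omega⟩
    · rcases k with _ | k
      · rw [mul_zero, zero_add, q1, map_sub, lC, l1, l0, sub_self]
      · have e := jDenom_add_two a b (3 * k + 2)
        have ha : a (3 * k + 2 + 1) = -u := h.a_zero (k + 1)
        have i2 := ih (3 * k + 1) (by omega)
        have i1 := ih k (by omega)
        rw [show 3 * (k + 1) + 1 = 3 * k + 2 + 2 by ring, e, ha, C_neg,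
          show 3 * k + 2 + 1 = 3 * (k + 1) by ring, add_mul, neg_mul, map_add, map_add, map_neg,
          lC, lC, l1, l0, i2, i1]
        ring
    · rcases k with _ | k
      · have i1 := ih 0 (by omega)
        rw [zero_add] at i1
        rw [mul_zero, zero_add, one_add_one_eq_two, q2]
        simp only [map_add, map_sub, lC]
        rw [l2, l1, l0, i1, hb1]
        ring
      · have e := jDenom_add_two a b (3 * k + 3)
        have e' := jDenom_add_two a b (3 * k + 2)
        have e'' := jDenom_add_two a b (3 * k + 1)
        have ha : a (3 * k + 3) = -u := h.a_zero (k + 1)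
        have i0 := ih (3 * k) (by omega)
        have i1 := ih (3 * k + 1) (by omega)
        have i3 := ih (3 * k + 3) (by omega)
        have ik := ih k (by omega)
        have l0' := l0 (k + 1)
        have l1' := l1 (k + 1)
        have l2' := l2 (k + 1)
        simp only [mul_add, mul_one, add_assoc, Nat.reduceAdd] at *
        -- The recurrence read backwards removes `X q_{3k+2}`, so that `X` only multiplies a
        -- denominator whose index is divisible by 3.
        have key : jDenom a b (3 * k + 5) = X ^ 2 * jDenom a b (3 * k + 3) -
            C u * (X * jDenom a b (3 * k + 3)) + C (b (3 * k + 3)) * (jDenom a b (3 * k + 3) -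
            C (a (3 * k + 2)) * jDenom a b (3 * k + 2) - C (b (3 * k + 2)) * jDenom a b (3 * k + 1))
            + C (a (3 * k + 4)) * jDenom a b (3 * k + 4)
            + C (b (3 * k + 4)) * jDenom a b (3 * k + 3) := by
          rw [ha, C_neg] at e'
          linear_combination e + X * e' - C (b (3 * k + 3)) * e''
        rw [key]
        simp only [map_add, map_sub, lC]
        rw [l2', l1', l0', i0, i1, i3, ik]
        ring
    · rw [show 3 * k + 2 + 1 = 3 * (k + 1) by ring, l0]
      exact ih k (by omega)

end IsSelfSimilar

/-! ### Orthogonality and nonvanishing of Hankel determinants. -/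

section Hankel

variable {F : Type*} [Field F] {a b f : ℕ → F}

/-- The recurrence trades a factor `X` for a shift of the index by at most one, so `j < n` is
preserved until `j = 0`. -/
theorem momentFunctional_X_pow_mul_jDenom_of_lt
    (hf : ∀ n, momentFunctional f (jDenom a b (n + 1)) = 0) (j n : ℕ) (hjn : j < n) :
    momentFunctional f (X ^ j * jDenom a b n) = 0 := by
  induction j generalizing n with
  | zero =>
    obtain ⟨n, rfl⟩ := Nat.exists_eq_succ_of_ne_zero hjn.ne'
    simpa using hf n
  | succ j ih =>
    obtain ⟨n, rfl⟩ : ∃ m, n = m + 1 := ⟨n - 1, by omega⟩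
    have e : X ^ (j + 1) * jDenom a b (n + 1) = X ^ j * jDenom a b (n + 2) -
        C (a (n + 1)) * (X ^ j * jDenom a b (n + 1)) - C (b (n + 1)) * (X ^ j * jDenom a b n) := by
      rw [jDenom_add_two]; ring
    rw [e, map_sub, map_sub, momentFunctional_C_mul, momentFunctional_C_mul, ih _ (by omega),
      ih _ (by omega), ih _ (by omega)]
    ring

/-- Passing from `n` to `n + 1` multiplies the value by `-b (n + 1)`. -/
theorem momentFunctional_X_pow_mul_jDenom_self_ne_zero (hf0 : f 0 ≠ 0) (hb : ∀ n, b (n + 1) ≠ 0)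
    (hf : ∀ n, momentFunctional f (jDenom a b (n + 1)) = 0) (n : ℕ) :
    momentFunctional f (X ^ n * jDenom a b n) ≠ 0 := by
  induction n with
  | zero =>
    have := momentFunctional_monomial f 0 1
    rw [monomial_zero_one, mul_one] at this
    simpa [jDenom, this] using hf0
  | succ n ih =>
    have e : X ^ (n + 1) * jDenom a b (n + 1) = X ^ n * jDenom a b (n + 2) -
        C (a (n + 1)) * (X ^ n * jDenom a b (n + 1)) - C (b (n + 1)) * (X ^ n * jDenom a b n) := by
      rw [jDenom_add_two]; ring
    rw [e, map_sub, map_sub, momentFunctional_C_mul, momentFunctional_C_mul,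
      momentFunctional_X_pow_mul_jDenom_of_lt hf _ _ (by omega),
      momentFunctional_X_pow_mul_jDenom_of_lt hf _ _ (by omega), mul_zero, sub_zero, zero_sub,
      neg_ne_zero]
    exact mul_ne_zero (hb n) ih

/-- If the moment functional annihilates the denominators of a J-fraction with nonzero
coefficients `b`, then the bilinear form `(g, h) ↦ L (g h)` is nondegenerate on polynomials of
bounded degree. -/
theorem exists_momentFunctional_ne_zero (hf0 : f 0 ≠ 0) (hb : ∀ n, b (n + 1) ≠ 0)
    (hf : ∀ n, momentFunctional f (jDenom a b (n + 1)) = 0) (h : F[X]) (hh : h ≠ 0) :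
    ∃ j ≤ h.natDegree, momentFunctional f (X ^ j * h) ≠ 0 := by
  by_contra! hcon
  have hq := jDenom_monic_natDegree a b h.natDegree
  -- The same value is computed twice: expanding the denominator in powers of `X` gives zero, while
  -- expanding `h` leaves only its leading term, by orthogonality.
  have h1 : momentFunctional f (jDenom a b h.natDegree * h) = 0 := by
    rw [(jDenom a b h.natDegree).as_sum_range_C_mul_X_pow, Finset.sum_mul, map_sum]
    refine Finset.sum_eq_zero fun i hi => ?_
    rw [hq.2, Finset.mem_range] at hi
    rw [mul_assoc, momentFunctional_C_mul, hcon i (by omega), mul_zero]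
  have h2 : momentFunctional f (jDenom a b h.natDegree * h) =
      h.leadingCoeff * momentFunctional f (X ^ h.natDegree * jDenom a b h.natDegree) := by
    have e : jDenom a b h.natDegree * h = ∑ i ∈ Finset.range (h.natDegree + 1),
        C (h.coeff i) * (X ^ i * jDenom a b h.natDegree) := by
      generalize jDenom a b h.natDegree = q
      conv_lhs => rw [mul_comm, h.as_sum_range_C_mul_X_pow, Finset.sum_mul]
      simp only [mul_assoc]
    rw [e, map_sum, Finset.sum_range_succ, Finset.sum_eq_zero, zero_add, momentFunctional_C_mul,
      h.coeff_natDegree]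
    intro i hi
    rw [momentFunctional_C_mul,
      momentFunctional_X_pow_mul_jDenom_of_lt hf _ _ (Finset.mem_range.1 hi), mul_zero]
  rw [h2] at h1
  exact mul_ne_zero (leadingCoeff_ne_zero.2 hh)
    (momentFunctional_X_pow_mul_jDenom_self_ne_zero hf0 hb hf _) h1

/-- The Hankel matrix `(f (i + j))` of size `n`. -/
def hankel {R : Type*} (f : ℕ → R) (n : ℕ) : Matrix (Fin n) (Fin n) R :=
  Matrix.of fun i j => f (i + j)

theorem momentFunctional_X_pow_mul_sum (n j : ℕ) (c : ℕ → F) :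
    momentFunctional f (X ^ j * ∑ i ∈ Finset.range n, monomial i (c i)) =
      ∑ i ∈ Finset.range n, f (j + i) * c i := by
  rw [Finset.mul_sum, map_sum]
  refine Finset.sum_congr rfl fun i _ => ?_
  rw [X_pow_mul_monomial, momentFunctional_monomial, add_comm]

/-- A kernel vector is the coefficient vector of a polynomial of degree less than `n` that pairs to
zero with every `X ^ j`, `j < n`. -/
theorem hankel_det_ne_zero
    (hf : ∀ h : F[X], h ≠ 0 → ∃ j ≤ h.natDegree, momentFunctional f (X ^ j * h) ≠ 0) (n : ℕ) :
    (hankel f n).det ≠ 0 := by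
  intro hdet
  obtain ⟨w, hw, hz⟩ := Matrix.exists_mulVec_eq_zero_iff.2 hdet
  set c : ℕ → F := fun i => if hi : i < n then w ⟨i, hi⟩ else 0 with hc
  set h : F[X] := ∑ i ∈ Finset.range n, monomial i (c i) with hh
  have hcoeff (i : Fin n) : h.coeff i = w i := by
    simp [hh, finsetSum_coeff, coeff_monomial, hc]
  obtain ⟨i₀, hi₀⟩ := Function.ne_iff.1 hw
  have hne : h ≠ 0 := fun h0 => hi₀ (by rw [← hcoeff, h0]; rfl)
  obtain ⟨j, hj, hjne⟩ := hf h hne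
  have hdeg : h.natDegree < n := by
    have : h.degree < n := by
      rw [← mem_degreeLT, hh]
      refine Submodule.sum_mem _ fun i hi => mem_degreeLT.2 ?_
      exact lt_of_le_of_lt (degree_monomial_le _ _) (by exact_mod_cast Finset.mem_range.1 hi)
    exact (natDegree_lt_iff_degree_lt hne).2 this
  apply hjne
  have := congrFun hz ⟨j, by omega⟩
  rw [hh, momentFunctional_X_pow_mul_sum, Finset.sum_range]
  simpa [Matrix.mulVec, dotProduct, hankel, hc] using this

end Hankel


/-! ### Solving the self-similarity relations by base 3 recursion. -/

section Parameters

variable {F : Type*} [Field F]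

/-- Parameters from which the coefficients of a self-similar J-fraction can be built. -/
structure IsParameter (u v s t x y : F) : Prop where
  two_ne_zero : (2 : F) ≠ 0
  s_ne_zero : s ≠ 0
  t_ne_zero : t ≠ 0
  add_ne_zero : s + t ≠ 0
  s_add_t : s + t = u ^ 2 - v
  mul_y : (s + t) * y = u * v - u
  mul_x : 2 * (s * x) = u * (1 + 2 * v - t)
  x_add_y : x + y = u
  mul_eq_one : s * (v - x * y) = 1
  degenerate : (4 * v - u ^ 2) * (t ^ 2 - 1) = 0

/-- The coefficients `a (3 * k + 2)` of a self-similar J-fraction. -/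
def coeffA (u t x y : F) (n : ℕ) : F :=
  if n % 3 = 0 then y else if n % 3 = 2 then x else (u * (1 + t) / 2 - coeffA u t x y (n / 3)) / t
termination_by n
decreasing_by omega

/-- The coefficients `b (3 * k)` of a self-similar J-fraction. -/
def coeffB (s t : F) (n : ℕ) : F :=
  if n = 0 then 0 else if n % 3 = 1 then s else if n % 3 = 2 then t else coeffB s t (n / 3)
termination_by n
decreasing_by omega

variable {u v s t x y : F}

theorem coeffA_three_mul (u t x y : F) (m : ℕ) : coeffA u t x y (3 * m) = y := by
  rw [coeffA, if_pos (by omega)]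

theorem coeffA_three_mul_add_two (u t x y : F) (m : ℕ) : coeffA u t x y (3 * m + 2) = x := by
  rw [coeffA, if_neg (by omega), if_pos (by omega)]

theorem coeffA_three_mul_add_one (u t x y : F) (m : ℕ) :
    coeffA u t x y (3 * m + 1) = (u * (1 + t) / 2 - coeffA u t x y m) / t := by
  rw [coeffA, if_neg (by omega), if_neg (by omega), show (3 * m + 1) / 3 = m by omega]

theorem coeffB_zero (s t : F) : coeffB s t 0 = 0 := by
  rw [coeffB, if_pos rfl]

theorem coeffB_three_mul_add_one (s t : F) (m : ℕ) : coeffB s t (3 * m + 1) = s := by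
  rw [coeffB, if_neg (by omega), if_pos (by omega)]

theorem coeffB_three_mul_add_two (s t : F) (m : ℕ) : coeffB s t (3 * m + 2) = t := by
  rw [coeffB, if_neg (by omega), if_neg (by omega), if_pos (by omega)]

theorem coeffB_three_mul (s t : F) (m : ℕ) : coeffB s t (3 * m) = coeffB s t m := by
  rcases Nat.eq_zero_or_pos m with rfl | hm
  · rfl
  · rw [coeffB, if_neg (by omega), if_neg (by omega), if_neg (by omega),
      show 3 * m / 3 = m by omega]

theorem coeffB_eq_or_eq (s t : F) (n : ℕ) : coeffB s t (n + 1) = s ∨ coeffB s t (n + 1) = t := by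
  induction n using Nat.strong_induction_on with
  | _ n ih =>
    obtain ⟨k, rfl | rfl | rfl⟩ : ∃ k, n = 3 * k ∨ n = 3 * k + 1 ∨ n = 3 * k + 2 :=
      ⟨n / 3, by omega⟩
    · exact .inl (coeffB_three_mul_add_one s t k)
    · exact .inr (coeffB_three_mul_add_two s t k)
    · rw [show 3 * k + 2 + 1 = 3 * (k + 1) by ring, coeffB_three_mul]
      exact ih k (by omega)

/-- The value of `b (3 * n + 2)` in a self-similar J-fraction. -/
def coeffC (u v t x y : F) (n : ℕ) : F :=
  v - (u - coeffA u t x y n) * coeffA u t x y n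

namespace IsParameter

theorem coeffC_three_mul (h : IsParameter u v s t x y) (m : ℕ) :
    s * coeffC u v t x y (3 * m) = 1 := by
  rw [coeffC, coeffA_three_mul, ← h.x_add_y, add_sub_cancel_right]
  exact h.mul_eq_one

theorem coeffC_three_mul_add_two (h : IsParameter u v s t x y) (m : ℕ) :
    s * coeffC u v t x y (3 * m + 2) = 1 := by
  rw [coeffC, coeffA_three_mul_add_two, ← h.x_add_y, add_sub_cancel_left, mul_comm y x]
  exact h.mul_eq_one

/-- Completing the square, `C = v - u²/4 + (A - u/2)²`, and the recursion divides `A - u/2` by `-t`.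
The constant part is compatible iff `(4v - u²)(t² - 1) = 0`. -/
theorem coeffC_three_mul_add_one (h : IsParameter u v s t x y) (m : ℕ) :
    t ^ 2 * coeffC u v t x y (3 * m + 1) = coeffC u v t x y m := by
  have h2 := h.two_ne_zero
  have ht := h.t_ne_zero
  have hd := h.degenerate
  rw [coeffC, coeffC, coeffA_three_mul_add_one]
  field_simp
  linear_combination hd

theorem coeffC_ne_zero (h : IsParameter u v s t x y) (n : ℕ) : coeffC u v t x y n ≠ 0 := by
  induction n using Nat.strong_induction_on with
  | _ n ih =>
    obtain ⟨k, rfl | rfl | rfl⟩ : ∃ k, n = 3 * k ∨ n = 3 * k + 1 ∨ n = 3 * k + 2 :=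
      ⟨n / 3, by omega⟩
    · exact right_ne_zero_of_mul (h.coeffC_three_mul k ▸ one_ne_zero)
    · exact right_ne_zero_of_mul (h.coeffC_three_mul_add_one k ▸ ih k (by omega))
    · exact right_ne_zero_of_mul (h.coeffC_three_mul_add_two k ▸ one_ne_zero)

end IsParameter

/-- The coefficients `a` of a self-similar J-fraction. -/
def jCoeffA (u t x y : F) (n : ℕ) : F :=
  if n % 3 = 0 then -u else if n % 3 = 1 then u - coeffA u t x y (n / 3)
  else coeffA u t x y (n / 3)

/-- The coefficients `b` of a self-similar J-fraction. -/
def jCoeffB (u v s t x y : F) (n : ℕ) : F :=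
  if n % 3 = 0 then coeffB s t (n / 3) else if n % 3 = 1 then s + t - coeffB s t (n / 3)
  else coeffC u v t x y (n / 3)

theorem jCoeffA_three_mul (u t x y : F) (k : ℕ) : jCoeffA u t x y (3 * k) = -u := by
  rw [jCoeffA, if_pos (by omega)]

theorem jCoeffA_three_mul_add_one (u t x y : F) (k : ℕ) :
    jCoeffA u t x y (3 * k + 1) = u - coeffA u t x y k := by
  rw [jCoeffA, if_neg (by omega), if_pos (by omega), show (3 * k + 1) / 3 = k by omega]

theorem jCoeffA_three_mul_add_two (u t x y : F) (k : ℕ) :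
    jCoeffA u t x y (3 * k + 2) = coeffA u t x y k := by
  rw [jCoeffA, if_neg (by omega), if_neg (by omega), show (3 * k + 2) / 3 = k by omega]

theorem jCoeffB_three_mul (u v s t x y : F) (k : ℕ) :
    jCoeffB u v s t x y (3 * k) = coeffB s t k := by
  rw [jCoeffB, if_pos (by omega), show (3 * k) / 3 = k by omega]

theorem jCoeffB_three_mul_add_one (u v s t x y : F) (k : ℕ) :
    jCoeffB u v s t x y (3 * k + 1) = s + t - coeffB s t k := by
  rw [jCoeffB, if_neg (by omega), if_pos (by omega), show (3 * k + 1) / 3 = k by omega]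

theorem jCoeffB_three_mul_add_two (u v s t x y : F) (k : ℕ) :
    jCoeffB u v s t x y (3 * k + 2) = coeffC u v t x y k := by
  rw [jCoeffB, if_neg (by omega), if_neg (by omega), show (3 * k + 2) / 3 = k by omega]

theorem jCoeffB_ne_zero (h : IsParameter u v s t x y) (n : ℕ) :
    jCoeffB u v s t x y (n + 1) ≠ 0 := by
  have hs := h.s_ne_zero
  have ht := h.t_ne_zero
  obtain ⟨k, rfl | rfl | rfl⟩ : ∃ k, n = 3 * k ∨ n = 3 * k + 1 ∨ n = 3 * k + 2 :=
    ⟨n / 3, by omega⟩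
  · rw [jCoeffB_three_mul_add_one]
    rcases k with _ | k
    · simpa [coeffB_zero] using h.add_ne_zero
    · rcases coeffB_eq_or_eq s t k with e | e <;> simpa [e]
  · rw [jCoeffB_three_mul_add_two]
    exact h.coeffC_ne_zero k
  · rw [show 3 * k + 2 + 1 = 3 * (k + 1) by ring, jCoeffB_three_mul]
    rcases coeffB_eq_or_eq s t k with e | e <;> simpa [e]

/-- For `k ≡ 0, 2` modulo 3 one factor is `s` and cancels against `coeffC`, as `s * C = 1`; for `k ≡
1` both outer factors are `t` and the recursion for `coeffC` applies. -/
theorem jCoeffB_mul (h : IsParameter u v s t x y) (k : ℕ) :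
    coeffB s t (k + 1) * coeffC u v t x y k * (s + t - coeffB s t k) =
      jCoeffB u v s t x y (k + 1) := by
  obtain ⟨m, rfl | rfl | rfl⟩ : ∃ m, k = 3 * m ∨ k = 3 * m + 1 ∨ k = 3 * m + 2 :=
    ⟨k / 3, by omega⟩
  · rw [coeffB_three_mul_add_one, h.coeffC_three_mul, one_mul, coeffB_three_mul,
      jCoeffB_three_mul_add_one]
  · rw [show 3 * m + 1 + 1 = 3 * m + 2 by ring, coeffB_three_mul_add_two,
      coeffB_three_mul_add_one, jCoeffB_three_mul_add_two, ← h.coeffC_three_mul_add_one m]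
    ring
  · rw [show 3 * m + 2 + 1 = 3 * (m + 1) by ring, jCoeffB_three_mul, coeffB_three_mul,
      coeffB_three_mul_add_two, add_sub_cancel_right]
    linear_combination coeffB s t (m + 1) * h.coeffC_three_mul_add_two m

/-- For `k ≡ 0` modulo 3 this relation dictates the recursion in `coeffA`. The residues 0 and 1 both
reduce to `mul_x`, the residue 2 to `mul_y`. -/
theorem jCoeffA_step (h : IsParameter u v s t x y) (k : ℕ) :
    (s + t - coeffB s t (k + 1)) * coeffA u t x y (k + 1) +
      coeffB s t (k + 1) * (u - coeffA u t x y k) = jCoeffA u t x y (k + 1) + u * v := by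
  have h2 := h.two_ne_zero
  have ht := h.t_ne_zero
  have hx := h.mul_x
  have hy := h.mul_y
  have hxy := h.x_add_y
  obtain ⟨m, rfl | rfl | rfl⟩ : ∃ m, k = 3 * m ∨ k = 3 * m + 1 ∨ k = 3 * m + 2 :=
    ⟨k / 3, by omega⟩
  · rw [coeffB_three_mul_add_one, coeffA_three_mul_add_one, coeffA_three_mul,
      jCoeffA_three_mul_add_one, add_sub_cancel_left, mul_div_cancel₀ _ ht]
    field_simp
    linear_combination hx - 2 * s * hxy
  · rw [show 3 * m + 1 + 1 = 3 * m + 2 by ring, coeffB_three_mul_add_two,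
      coeffA_three_mul_add_one, coeffA_three_mul_add_two, jCoeffA_three_mul_add_two]
    field_simp
    linear_combination hx
  · rw [show 3 * m + 2 + 1 = 3 * (m + 1) by ring, jCoeffA_three_mul, coeffA_three_mul,
      coeffA_three_mul_add_two]
    linear_combination hy - coeffB s t (3 * (m + 1)) * hxy

theorem IsParameter.isSelfSimilar (h : IsParameter u v s t x y) :
    IsSelfSimilar u v (jCoeffA u t x y) (jCoeffB u v s t x y) where
  a_zero := jCoeffA_three_mul u t x y
  a_add k := by rw [jCoeffA_three_mul_add_one, jCoeffA_three_mul_add_two, sub_add_cancel]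
  b_two k := by
    rw [jCoeffA_three_mul_add_one, jCoeffA_three_mul_add_two, jCoeffB_three_mul_add_two, coeffC]
  b_zero := (jCoeffB_three_mul u v s t x y 0).trans (coeffB_zero s t)
  b_add k := by
    rw [jCoeffB_three_mul, jCoeffB_three_mul_add_one, add_sub_cancel, h.s_add_t]
  b_mul k := by
    rw [show 3 * k + 3 = 3 * (k + 1) by ring, jCoeffB_three_mul, jCoeffB_three_mul_add_one,
      jCoeffB_three_mul_add_two, jCoeffB_mul h]
  base := by
    have e1 := jCoeffB_three_mul_add_one u v s t x y 0
    have e2 := jCoeffA_three_mul_add_two u t x y 0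
    have e3 := jCoeffA_three_mul u t x y 0
    have e4 := coeffA_three_mul u t x y 0
    rw [mul_zero] at e1 e2 e3 e4
    rw [zero_add] at e1 e2
    rw [e1, e2, e3, e4, coeffB_zero]
    linear_combination h.mul_y
  step k := by
    rw [show 3 * k + 4 = 3 * (k + 1) + 1 by ring, show 3 * k + 5 = 3 * (k + 1) + 2 by ring,
      show 3 * k + 3 = 3 * (k + 1) by ring, jCoeffB_three_mul, jCoeffB_three_mul_add_one,
      jCoeffA_three_mul_add_two, jCoeffA_three_mul_add_one, jCoeffA_step h]
  b_ne_zero := jCoeffB_ne_zero h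

/-- This accounts for the signs `±` of `u` in the conditions; it reflects the substitution of `-z`
for `z`. -/
theorem IsParameter.neg (h : IsParameter u v s t x y) : IsParameter (-u) v s t (-x) (-y) where
  two_ne_zero := h.two_ne_zero
  s_ne_zero := h.s_ne_zero
  t_ne_zero := h.t_ne_zero
  add_ne_zero := h.add_ne_zero
  s_add_t := by linear_combination h.s_add_t
  mul_y := by linear_combination -h.mul_y
  mul_x := by linear_combination -h.mul_x
  x_add_y := by linear_combination -h.x_add_y
  mul_eq_one := by linear_combination h.mul_eq_one
  degenerate := by linear_combination h.degenerate

end Parameters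

/-! ### Explicit parameters for the seven conditions. -/

section Cases

variable {F : Type*} [Field F] {u v φ δ : F}

/-- Taking `t = ±1` makes `degenerate` automatic. Every family except the last does so, with `s = u²
- v - t`. -/
theorem isParameter_of_sq_eq_three (h2 : (2 : F) ≠ 0) (hu : u ^ 2 = 3) :
    IsParameter u 1 1 1 u 0 where
  two_ne_zero := h2
  s_ne_zero := one_ne_zero
  t_ne_zero := one_ne_zero
  add_ne_zero := by rwa [one_add_one_eq_two]
  s_add_t := by linear_combination -hu
  mul_y := by ring
  mul_x := by ring
  x_add_y := by ring
  mul_eq_one := by ring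
  degenerate := by ring

theorem isParameter_of_sq_eq_neg_three (h2 : (2 : F) ≠ 0) (hu : u ^ 2 = -3) :
    IsParameter u (-1) (-1) (-1) 0 u where
  two_ne_zero := h2
  s_ne_zero := neg_ne_zero.2 one_ne_zero
  t_ne_zero := neg_ne_zero.2 one_ne_zero
  add_ne_zero := fun h => h2 (by linear_combination -h)
  s_add_t := by linear_combination -hu
  mul_y := by ring
  mul_x := by ring
  x_add_y := by ring
  mul_eq_one := by ring
  degenerate := by ring

theorem ne_zero_of_sq_add_self_add_one (h : φ ^ 2 + φ + 1 = 0) : φ ≠ 0 := by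
  rintro rfl; simp at h

theorem isParameter_of_right_eq_zero (h2 : (2 : F) ≠ 0) (hφ : φ ^ 2 + φ + 1 = 0) :
    IsParameter φ 0 (-φ) (-1) (-1) (1 + φ) where
  two_ne_zero := h2
  s_ne_zero := neg_ne_zero.2 (ne_zero_of_sq_add_self_add_one hφ)
  t_ne_zero := neg_ne_zero.2 one_ne_zero
  add_ne_zero := fun h => pow_ne_zero 2 (ne_zero_of_sq_add_self_add_one hφ)
    (by linear_combination hφ + h)
  s_add_t := by linear_combination -hφ
  mul_y := by linear_combination -hφ
  mul_x := by ring
  x_add_y := by ring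
  mul_eq_one := by linear_combination -hφ
  degenerate := by ring

theorem isParameter_of_pow_four (h2 : (2 : F) ≠ 0) (hφ : φ ^ 4 + 4 * φ ^ 2 + 1 = 0) :
    IsParameter φ (-1) (φ ^ 2) 1 (φ ^ 3 + 4 * φ) (-(φ ^ 3 + 3 * φ)) where
  two_ne_zero := h2
  s_ne_zero := by
    refine pow_ne_zero 2 ?_
    rintro rfl
    simp at hφ
  t_ne_zero := one_ne_zero
  -- `φ^4 + 4φ^2 + 1 = (φ^2 + 1)(φ^2 + 3) - 2`, so `φ^2 + 1 = 0` would give `2 = 0`.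
  add_ne_zero := fun h => h2 (by linear_combination (φ ^ 2 + 3) * h - hφ)
  s_add_t := by ring
  mul_y := by linear_combination -φ * hφ
  mul_x := by linear_combination 2 * φ * hφ
  x_add_y := by ring
  mul_eq_one := by linear_combination (φ ^ 4 + 3 * φ ^ 2 - 1) * hφ
  degenerate := by ring

theorem isParameter_of_sq_eq_two_mul (h2 : (2 : F) ≠ 0) (hδ : δ ^ 2 - δ + 1 = 0)
    (hφ : φ ^ 2 = 2 * δ) : IsParameter φ δ (δ - 1) 1 (φ * (1 - δ)) (φ * δ) where
  two_ne_zero := h2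
  s_ne_zero := fun h => one_ne_zero (α := F) (by linear_combination hδ - δ * h)
  t_ne_zero := one_ne_zero
  add_ne_zero := fun h => one_ne_zero (α := F) (by linear_combination hδ - (δ - 1) * h)
  s_add_t := by linear_combination -hφ
  mul_y := by linear_combination φ * hδ
  mul_x := by linear_combination -2 * φ * hδ
  x_add_y := by ring
  mul_eq_one := by
    linear_combination δ * (δ - 1) ^ 2 * hφ + (2 * δ ^ 2 - 2 * δ - 1) * hδ
  degenerate := by ring

theorem isParameter_of_left_eq_zero (h2 : (2 : F) ≠ 0) (hδ : δ ^ 2 + δ + 1 = 0) :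
    IsParameter 0 δ (-δ - 1) 1 0 0 where
  two_ne_zero := h2
  s_ne_zero := fun h => pow_ne_zero 2 (ne_zero_of_sq_add_self_add_one hδ)
    (by linear_combination hδ + h)
  t_ne_zero := one_ne_zero
  add_ne_zero := by simpa using ne_zero_of_sq_add_self_add_one hδ
  s_add_t := by ring
  mul_y := by ring
  mul_x := by ring
  x_add_y := by ring
  mul_eq_one := by linear_combination -hδ
  degenerate := by ring

theorem isParameter_of_left_eq_zero' (h2 : (2 : F) ≠ 0) (hδ : δ ^ 2 + δ + 1 = 0) :
    IsParameter 0 (-δ) (δ + 1) (-1) 0 0 where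
  two_ne_zero := h2
  s_ne_zero := fun h => pow_ne_zero 2 (ne_zero_of_sq_add_self_add_one hδ)
    (by linear_combination hδ - h)
  t_ne_zero := neg_ne_zero.2 one_ne_zero
  add_ne_zero := by simpa using ne_zero_of_sq_add_self_add_one hδ
  s_add_t := by ring
  mul_y := by ring
  mul_x := by ring
  x_add_y := by ring
  mul_eq_one := by linear_combination -hδ
  degenerate := by ring

/-- Here `t² - 1 = 8 ≠ 0`, and `degenerate` holds because `δ³ = 1` gives `u² = 4δ^4 = 4v`.
Characteristic 3 is excluded since `t = -3`. -/
theorem isParameter_of_eq_two_mul_sq (h2 : (2 : F) ≠ 0) (h3 : (3 : F) ≠ 0)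
    (hδ : δ ^ 2 + δ + 1 = 0) :
    IsParameter (2 * δ ^ 2) δ (-3 * δ ^ 2) (-3) ((-4 - 2 * δ) / 3) ((-2 - 4 * δ) / 3) where
  two_ne_zero := h2
  s_ne_zero :=
    mul_ne_zero (neg_ne_zero.2 h3) (pow_ne_zero 2 (ne_zero_of_sq_add_self_add_one hδ))
  t_ne_zero := neg_ne_zero.2 h3
  add_ne_zero := fun h => mul_ne_zero h3 (ne_zero_of_sq_add_self_add_one hδ)
    (by linear_combination 3 * hδ + h)
  s_add_t := by linear_combination (-4 * δ ^ 2 + 4 * δ - 3) * hδ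
  mul_y := by
    field_simp
    linear_combination (2 * δ + 2) * hδ
  mul_x := by
    field_simp
    ring
  x_add_y := by
    field_simp
    linear_combination -6 * hδ
  mul_eq_one := by
    field_simp
    linear_combination (8 * δ ^ 2 + 3 * δ - 3) * hδ
  degenerate := by linear_combination -32 * δ * (δ - 1) * hδ

end Cases


/-! ### Coefficients of the infinite product. -/

section Moments

/-- The sequence `c` with `c 0 = 1`, `c (3 n) = c n`, `c (3 n + 1) = u c n` and
`c (3 n + 2) = v c n`. -/
def ternarySeq {R : Type*} [CommRing R] (u v : R) (n : ℕ) : R :=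
  if n = 0 then 1 else
    (if n % 3 = 0 then 1 else if n % 3 = 1 then u else v) * ternarySeq u v (n / 3)
termination_by n
decreasing_by omega

variable {R : Type*} [CommRing R] (u v : R)

theorem ternarySeq_zero : ternarySeq u v 0 = 1 := by
  rw [ternarySeq, if_pos rfl]

theorem ternarySeq_three_mul (n : ℕ) : ternarySeq u v (3 * n) = ternarySeq u v n := by
  rcases Nat.eq_zero_or_pos n with rfl | hn
  · rfl
  · rw [ternarySeq, if_neg (by omega), if_pos (by omega), one_mul,
      show 3 * n / 3 = n by omega]

theorem ternarySeq_three_mul_add_one (n : ℕ) :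
    ternarySeq u v (3 * n + 1) = u * ternarySeq u v n := by
  rw [ternarySeq, if_neg (by omega), if_neg (by omega), if_pos (by omega),
    show (3 * n + 1) / 3 = n by omega]

theorem ternarySeq_three_mul_add_two (n : ℕ) :
    ternarySeq u v (3 * n + 2) = v * ternarySeq u v n := by
  rw [ternarySeq, if_neg (by omega), if_neg (by omega), if_neg (by omega),
    show (3 * n + 2) / 3 = n by omega]

theorem map_ternarySeq {S : Type*} [CommRing S] (φ : R →+* S) (n : ℕ) :
    φ (ternarySeq u v n) = ternarySeq (φ u) (φ v) n := by
  induction n using Nat.strong_induction_on with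
  | _ n ih =>
    rcases Nat.eq_zero_or_pos n with rfl | hn
    · rw [ternarySeq_zero, ternarySeq_zero, map_one]
    obtain ⟨k, rfl | rfl | rfl⟩ : ∃ k, n = 3 * k ∨ n = 3 * k + 1 ∨ n = 3 * k + 2 :=
      ⟨n / 3, by omega⟩
    · rw [ternarySeq_three_mul, ternarySeq_three_mul, ih k (by omega)]
    · rw [ternarySeq_three_mul_add_one, ternarySeq_three_mul_add_one, map_mul, ih k (by omega)]
    · rw [ternarySeq_three_mul_add_two, ternarySeq_three_mul_add_two, map_mul, ih k (by omega)]

end Moments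

section InfProd

variable {F : Type*} [Field F] (u v : F)

theorem partialProd_succ (N : ℕ) : partialProd u v (N + 1) = partialProd u v N +
    PowerSeries.C u * (partialProd u v N * PowerSeries.X ^ (3 ^ N)) +
    PowerSeries.C v * (partialProd u v N * PowerSeries.X ^ (2 * 3 ^ N)) := by
  rw [partialProd, Finset.prod_range_succ, ← partialProd]
  ring

theorem coeff_mul_X_pow_three_mul {p q : PowerSeries F} {c : F} {r : ℕ} (hr : r < 3)
    (h : ∀ n, PowerSeries.coeff (3 * n + r) p = c * PowerSeries.coeff n q) (m n : ℕ) :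
    PowerSeries.coeff (3 * n + r) (p * PowerSeries.X ^ (3 * m)) =
      c * PowerSeries.coeff n (q * PowerSeries.X ^ m) := by
  rw [PowerSeries.coeff_mul_X_pow', PowerSeries.coeff_mul_X_pow']
  by_cases hmn : m ≤ n
  · rw [if_pos (by omega), if_pos hmn, show 3 * n + r - 3 * m = 3 * (n - m) + r by omega, h]
  · rw [if_neg (by omega), if_neg hmn, mul_zero]

/-- Coefficientwise form of `P_{N+1}(x) = (1 + u x + v x²) P_N(x³)`; `c` is `1`, `u` or `v`
according to `r`. -/
theorem coeff_partialProd_succ_three_mul (N : ℕ) {c : F} {r : ℕ} (hr : r < 3)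
    (h : PowerSeries.coeff r (partialProd u v 1) = c) (n : ℕ) :
    PowerSeries.coeff (3 * n + r) (partialProd u v (N + 1)) =
      c * PowerSeries.coeff n (partialProd u v N) := by
  induction N generalizing n with
  | zero =>
    rcases n with _ | n
    · rw [mul_zero, zero_add, zero_add, h]
      simp [partialProd]
    · have h1 : 3 * (n + 1) + r ≠ 1 := by omega
      have h2 : 3 * (n + 1) + r ≠ 2 := by omega
      simp [partialProd, PowerSeries.coeff_one, PowerSeries.coeff_X, PowerSeries.coeff_X_pow, h1,
        h2]
  | succ N ih =>
    rw [partialProd_succ u v (N + 1)]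
    simp only [map_add, PowerSeries.coeff_C_mul]
    rw [pow_succ', show 2 * (3 * 3 ^ N) = 3 * (2 * 3 ^ N) by ring,
      coeff_mul_X_pow_three_mul hr ih, coeff_mul_X_pow_three_mul hr ih, ih, partialProd_succ u v N]
    simp only [map_add, PowerSeries.coeff_C_mul]
    ring

theorem coeff_infProd_three_mul {c : F} {r : ℕ} (hr : r < 3)
    (h : PowerSeries.coeff r (partialProd u v 1) = c) (n : ℕ) :
    PowerSeries.coeff (3 * n + r) (infProd u v) = c * PowerSeries.coeff n (infProd u v) := by
  rw [← coeff_partialProd u v (show 3 * n + r ≤ 3 * n + r + 1 by omega),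
    ← coeff_partialProd u v (show n ≤ 3 * n + r by omega),
    coeff_partialProd_succ_three_mul u v _ hr h]

theorem coeff_infProd (n : ℕ) : PowerSeries.coeff n (infProd u v) = ternarySeq u v n := by
  induction n using Nat.strong_induction_on with
  | _ n ih =>
    rcases Nat.eq_zero_or_pos n with rfl | hn
    · simp [infProd, partialProd, ternarySeq_zero]
    obtain ⟨k, rfl | rfl | rfl⟩ : ∃ k, n = 3 * k ∨ n = 3 * k + 1 ∨ n = 3 * k + 2 :=
      ⟨n / 3, by omega⟩
    · rw [ternarySeq_three_mul, ← ih k (by omega), ← one_mul (PowerSeries.coeff k _)]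
      refine coeff_infProd_three_mul u v (r := 0) (by norm_num) ?_ k
      simp [partialProd]
    · rw [ternarySeq_three_mul_add_one, ← ih k (by omega)]
      refine coeff_infProd_three_mul u v (by norm_num) ?_ k
      simp [partialProd, PowerSeries.coeff_one, PowerSeries.coeff_X_pow]
    · rw [ternarySeq_three_mul_add_two, ← ih k (by omega)]
      refine coeff_infProd_three_mul u v (by norm_num) ?_ k
      simp [partialProd, PowerSeries.coeff_one, PowerSeries.coeff_X_pow]

theorem coeff_gSeries (n : ℕ) : (gSeries u v).coeff ((n : ℤ) + 1) = ternarySeq u v n := by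
  rw [gSeries, HahnSeries.coeff_single_mul_add, one_mul, ← coeff_infProd]
  exact HahnSeries.ofPowerSeries_apply_coeff _ n

end InfProd

/-! ### From Hankel determinants to linear partial quotients. -/

section ContinuedFraction

variable {F : Type*} [Field F]

theorem ofPoly_monomial (n : ℕ) (c : F) :
    ofPoly (monomial n c) = HahnSeries.single (-(n : ℤ)) c := by
  rw [ofPoly, coe_eval₂RingHom, eval₂_monomial, HahnSeries.single_pow, one_pow, HahnSeries.C_apply,
    HahnSeries.single_mul_single]
  simp

theorem coeff_ofPoly_mul (q : F[X]) (g : LaurentSeries F) (n : ℤ) :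
    (ofPoly q * g).coeff n = q.sum fun i c => c * g.coeff (n + i) := by
  induction q using Polynomial.induction_on' with
  | add p q hp hq =>
    rw [map_add, add_mul, HahnSeries.coeff_add, hp, hq,
      sum_add_index _ _ _ (by simp) (by intros; ring)]
  | monomial m c =>
    rw [ofPoly_monomial, HahnSeries.coeff_single_mul, sum_monomial_index _ _ (by simp),
      sub_neg_eq_add]

theorem coeff_ofPoly (q : F[X]) (n : ℕ) : (ofPoly q).coeff (-(n : ℤ)) = q.coeff n := by
  induction q using Polynomial.induction_on' with
  | add p q hp hq => rw [map_add, HahnSeries.coeff_add, hp, hq, coeff_add]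
  | monomial m c =>
    rw [ofPoly_monomial, HahnSeries.coeff_single, coeff_monomial]
    simp [eq_comm]

theorem coeff_ofPoly_of_pos (q : F[X]) {n : ℤ} (hn : 0 < n) : (ofPoly q).coeff n = 0 := by
  induction q using Polynomial.induction_on' with
  | add p q hp hq => rw [map_add, HahnSeries.coeff_add, hp, hq, add_zero]
  | monomial m c =>
    rw [ofPoly_monomial, HahnSeries.coeff_single_of_ne (by omega)]

theorem one_le_order_sub_polyPart {f : LaurentSeries F} (h : f - ofPoly (polyPart f) ≠ 0) :
    1 ≤ (f - ofPoly (polyPart f)).order := by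
  rw [HahnSeries.le_order_iff_forall h]
  intro n hn
  obtain ⟨m, rfl⟩ : ∃ m : ℕ, n = -(m : ℤ) := ⟨(-n).toNat, by omega⟩
  rw [HahnSeries.coeff_sub, coeff_ofPoly, coeff_polyPart, sub_self]

theorem natDegree_polyPart {f : LaurentSeries F} {n : ℕ} (h0 : f ≠ 0) (h : f.order = -(n : ℤ)) :
    (polyPart f).natDegree = n := by
  refine natDegree_eq_of_le_of_coeff_ne_zero ?_ ?_
  · rw [natDegree_le_iff_coeff_eq_zero]
    intro m hm
    rw [coeff_polyPart]
    exact HahnSeries.coeff_eq_zero_of_lt_order (by omega)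
  · rw [coeff_polyPart, ← h]
    exact fun e => h0 (HahnSeries.coeff_order_eq_zero.1 e)

/-- `g` is normal if no polynomial `q` approximates it better than expected: the distance of `q g`
to the polynomials is at least `|q|⁻¹ |z|⁻¹`. -/
def IsNormal (g : LaurentSeries F) : Prop :=
  ∀ q p : F[X], q ≠ 0 → ∃ n : ℕ, n ≤ q.natDegree + 1 ∧ (ofPoly q * g - ofPoly p).coeff (n : ℤ) ≠ 0

theorem IsNormal.ne_zero {g : LaurentSeries F} (h : IsNormal g) {q : F[X]} (p : F[X])
    (hq : q ≠ 0) : ofPoly q * g - ofPoly p ≠ 0 := by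
  obtain ⟨n, -, hn⟩ := h q p hq
  intro e
  simp [e] at hn

theorem IsNormal.order_le {g : LaurentSeries F} (h : IsNormal g) {q : F[X]} (p : F[X])
    (hq : q ≠ 0) : (ofPoly q * g - ofPoly p).order ≤ q.natDegree + 1 := by
  obtain ⟨n, hle, hn⟩ := h q p hq
  exact (HahnSeries.order_le_of_coeff_ne_zero hn).trans (by exact_mod_cast hle)

/-- The denominators including `q₋₁ = 0`: the value at `k` is `q_{k-1}`. -/
def convDenomPred (f : LaurentSeries F) : ℕ → F[X]
  | 0 => 0
  | k + 1 => convDenom f k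

theorem convDenom_succ (f : LaurentSeries F) (k : ℕ) :
    convDenom f (k + 1) =
      partialQuotient f (k + 1) * convDenom f k + convDenomPred f k := by
  cases k <;> simp [convDenom, convDenomPred]

/-- With `θ_k = q_k g - p_k`, the complete quotient of index `k + 1` is `-θ_{k-1} / θ_k`. Orders `k`
and `k + 1` give it order `-1`, so the partial quotient is linear and the induction continues. -/
theorem IsNormal.order_remainder {g : LaurentSeries F} (h : IsNormal g) (k : ℕ) :
    (convDenom g k).natDegree = k ∧ convDenom g k ≠ 0 ∧ (convDenomPred g k).natDegree < k + 1 ∧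
    ∃ p p' : F[X], (ofPoly (convDenom g k) * g - ofPoly p).order = k + 1 ∧
      completeQuotient g (k + 1) * (ofPoly (convDenom g k) * g - ofPoly p) =
        -(ofPoly (convDenomPred g k) * g - ofPoly p') ∧
      ofPoly (convDenomPred g k) * g - ofPoly p' ≠ 0 ∧
      (ofPoly (convDenomPred g k) * g - ofPoly p').order = k := by
  induction k with
  | zero =>
    have hne : g - ofPoly (polyPart g) ≠ 0 := by
      simpa using h.ne_zero (polyPart g) (one_ne_zero (α := F[X]))
    have hle : (g - ofPoly (polyPart g)).order ≤ 1 := by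
      simpa using h.order_le (polyPart g) (one_ne_zero (α := F[X]))
    have hge := one_le_order_sub_polyPart hne
    -- The convention `q_{-1} = 0`, `p_{-1} = 1` gives `θ_{-1} = -1`, of order 0.
    refine ⟨natDegree_one, one_ne_zero, by simp [convDenomPred], polyPart g, 1, ?_⟩
    simp only [convDenom, convDenomPred, completeQuotient, map_one, map_zero, one_mul, zero_mul,
      zero_sub, neg_neg]
    refine ⟨by simp; omega, inv_mul_cancel₀ hne, by simp, by simp [HahnSeries.order_neg]⟩
  | succ k ih =>
    obtain ⟨hdeg, hq, hpred, p, p', hord, hmul, hne', hord'⟩ := ih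
    set θ := ofPoly (convDenom g k) * g - ofPoly p with hθ
    set θ' := ofPoly (convDenomPred g k) * g - ofPoly p' with hθ'
    set c := completeQuotient g (k + 1) with hc
    have hθne : θ ≠ 0 := h.ne_zero p hq
    have hcne : c ≠ 0 := by
      intro e
      rw [e, zero_mul, eq_comm, neg_eq_zero] at hmul
      exact hne' hmul
    have hcord : c.order = -((1 : ℕ) : ℤ) := by
      have := congrArg HahnSeries.order hmul
      rw [HahnSeries.order_mul hcne hθne, HahnSeries.order_neg, hord, hord'] at this
      push_cast
      omega
    have ha : (partialQuotient g (k + 1)).natDegree = 1 := natDegree_polyPart hcne hcord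
    have hane : partialQuotient g (k + 1) ≠ 0 := by
      intro e; rw [e] at ha; simp at ha
    have hdegmul : (partialQuotient g (k + 1) * convDenom g k).natDegree = k + 1 := by
      rw [natDegree_mul hane hq, ha, hdeg, add_comm]
    have hdeg1 : (convDenom g (k + 1)).natDegree = k + 1 := by
      rw [convDenom_succ, natDegree_add_eq_left_of_natDegree_lt (by rwa [hdegmul]), hdegmul]
    have hq1 : convDenom g (k + 1) ≠ 0 := by
      intro e; rw [e] at hdeg1; simp at hdeg1
    have key : ofPoly (convDenom g (k + 1)) * g - ofPoly (partialQuotient g (k + 1) * p + p') =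
        -((c - ofPoly (partialQuotient g (k + 1))) * θ) := by
      rw [sub_mul, hmul, hθ', hθ, convDenom_succ, map_add, map_add, map_mul, map_mul]
      ring
    have hne1 := h.ne_zero (partialQuotient g (k + 1) * p + p') hq1
    have hle1 := h.order_le (partialQuotient g (k + 1) * p + p') hq1
    have hfrac : c - ofPoly (partialQuotient g (k + 1)) ≠ 0 := by
      intro e
      rw [key, e, zero_mul, neg_zero] at hne1
      exact hne1 rfl
    have hfracord : 1 ≤ (c - ofPoly (partialQuotient g (k + 1))).order :=
      one_le_order_sub_polyPart hfrac
    -- The order is squeezed: the fractional part adds at least 1 to the order of `θ`, and normality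
    -- bounds the result by `deg q_{k+1} + 1 = k + 2`.
    have hord1 := congrArg HahnSeries.order key
    rw [HahnSeries.order_neg, HahnSeries.order_mul hfrac hθne, hord] at hord1
    rw [hdeg1] at hle1
    refine ⟨hdeg1, hq1, hdeg.trans_lt (by omega), partialQuotient g (k + 1) * p + p', p, ?_, ?_, hθne, ?_⟩
    · push_cast at hle1 ⊢
      omega
    · rw [key]
      have : completeQuotient g (k + 1 + 1) = (c - ofPoly (partialQuotient g (k + 1)))⁻¹ := rfl
      rw [this, mul_neg, inv_mul_cancel_left₀ hfrac]
      rfl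
    · rw [← Nat.cast_succ] at hord
      exact hord

theorem IsNormal.natDegree_convDenom {g : LaurentSeries F} (h : IsNormal g) (k : ℕ) :
    (convDenom g k).natDegree = k := (h.order_remainder k).1

theorem IsNormal.natDegree_partialQuotient {g : LaurentSeries F} (h : IsNormal g) (k : ℕ) :
    (partialQuotient g (k + 1)).natDegree = 1 := by
  obtain ⟨-, hq, -, p, p', hord, hmul, hne', hord'⟩ := h.order_remainder k
  have hcne : completeQuotient g (k + 1) ≠ 0 := by
    intro e
    rw [e, zero_mul, eq_comm, neg_eq_zero] at hmul
    exact hne' hmul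
  refine natDegree_polyPart hcne ?_
  have := congrArg HahnSeries.order hmul
  rw [HahnSeries.order_mul hcne (h.ne_zero p hq), HahnSeries.order_neg, hord, hord'] at this
  push_cast
  omega

/-- The coefficients of `z^{-1}, …, z^{-(deg q + 1)}` in `q g` are the Hankel matrix of size `deg q
+ 1` applied to the coefficients of `q`, and subtracting `p` does not affect them. -/
theorem isNormal_of_hankel_det_ne_zero {g : LaurentSeries F} {f : ℕ → F}
    (hg : ∀ n : ℕ, g.coeff ((n : ℤ) + 1) = f n) (hf : ∀ n, (hankel f n).det ≠ 0) : IsNormal g := by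
  intro q p hq
  by_contra! hcon
  have hmul : (hankel f (q.natDegree + 1)).mulVec (fun i => q.coeff i) = 0 := by
    ext j
    have hj := hcon (j + 1) (by omega)
    rw [HahnSeries.coeff_sub, coeff_ofPoly_of_pos _ (by positivity), sub_zero, coeff_ofPoly_mul,
      sum_over_range _ (by simp), Finset.sum_range] at hj
    rw [Pi.zero_apply, ← hj, Matrix.mulVec, dotProduct]
    refine Finset.sum_congr rfl fun i _ => ?_
    rw [hankel, Matrix.of_apply, mul_comm, ← hg]
    congr 2
    push_cast
    ring
  refine hf _ (Matrix.exists_mulVec_eq_zero_iff.1 ⟨_, ?_, hmul⟩)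
  intro e
  have := congrFun e (Fin.last _)
  simp [hq] at this

end ContinuedFraction

/-! ### Reduction modulo `p`. -/

section Reduction

theorem hankel_ternarySeq_det_ne_zero {F : Type*} [Field F] {u v : F} {a b : ℕ → F}
    (h : IsSelfSimilar u v a b) (n : ℕ) : (hankel (ternarySeq u v) n).det ≠ 0 :=
  hankel_det_ne_zero (fun q hq => exists_momentFunctional_ne_zero
    (by rw [ternarySeq_zero]; exact one_ne_zero) h.b_ne_zero
    (h.momentFunctional_jDenom (ternarySeq_three_mul u v) (ternarySeq_three_mul_add_one u v)
      (ternarySeq_three_mul_add_two u v)) q hq) n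

theorem map_det_hankel_ternarySeq {R S : Type*} [CommRing R] [CommRing S] (φ : R →+* S)
    (u v : R) (n : ℕ) :
    φ (hankel (ternarySeq u v) n).det = (hankel (ternarySeq (φ u) (φ v)) n).det := by
  rw [RingHom.map_det]
  congr 1
  ext i j
  exact map_ternarySeq u v φ _

/-- The Hankel determinants over `ℚ` and over `F` are images of the same integer; a nonzero image in
`F` makes that integer nonzero, hence also its image in `ℚ`. -/
theorem isNormal_gSeries_of_isSelfSimilar {F : Type*} [Field F] {u v : ℤ} {a b : ℕ → F}
    (h : IsSelfSimilar (u : F) (v : F) a b) : IsNormal (gSeries (u : ℚ) (v : ℚ)) := by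
  refine isNormal_of_hankel_det_ne_zero (coeff_gSeries _ _) fun n => ?_
  have hF := hankel_ternarySeq_det_ne_zero h n
  have eF := map_det_hankel_ternarySeq (Int.castRingHom F) u v n
  have eQ := map_det_hankel_ternarySeq (Int.castRingHom ℚ) u v n
  simp only [eq_intCast] at eF eQ
  rw [← eQ, Int.cast_ne_zero]
  intro e
  rw [← eF, e, Int.cast_zero] at hF
  exact hF rfl

end Reduction

end LaurentCF

end

theorem theorem1 (p : ℕ) (hp : p.Prime) (hp3 : 3 ≤ p) (u v : ℤ)
    (huv :
      (u ^ 2 ≡ 3 [ZMOD p] ∧ v ≡ 1 [ZMOD p]) ∨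
      (u ^ 2 ≡ -3 [ZMOD p] ∧ v ≡ -1 [ZMOD p]) ∨
      (∃ φ : ℤ, φ ^ 2 + φ + 1 ≡ 0 [ZMOD p] ∧
        (u ≡ φ [ZMOD p] ∨ u ≡ -φ [ZMOD p]) ∧ v ≡ 0 [ZMOD p]) ∨
      (∃ φ : ℤ, φ ^ 4 + 4 * φ ^ 2 + 1 ≡ 0 [ZMOD p] ∧
        (u ≡ φ [ZMOD p] ∨ u ≡ -φ [ZMOD p]) ∧ v ≡ -1 [ZMOD p]) ∨
      (∃ φ δ : ℤ, δ ^ 2 - δ + 1 ≡ 0 [ZMOD p] ∧ φ ^ 2 ≡ 2 * δ [ZMOD p] ∧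
        (u ≡ φ [ZMOD p] ∨ u ≡ -φ [ZMOD p]) ∧ v ≡ δ [ZMOD p]) ∨
      (∃ δ : ℤ, δ ^ 2 + δ + 1 ≡ 0 [ZMOD p] ∧
        u ≡ 0 [ZMOD p] ∧ (v ≡ δ [ZMOD p] ∨ v ≡ -δ [ZMOD p])) ∨
      (p ≠ 3 ∧ ∃ δ : ℤ, δ ^ 2 + δ + 1 ≡ 0 [ZMOD p] ∧
        (u ≡ 2 * δ ^ 2 [ZMOD p] ∨ u ≡ -(2 * δ ^ 2) [ZMOD p]) ∧ v ≡ δ [ZMOD p])) :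
    (∀ k : ℕ, 1 ≤ k →
      (LaurentCF.partialQuotient (LaurentCF.gSeries (u : ℚ) (v : ℚ)) k).natDegree = 1) ∧
    (∀ k : ℕ,
      (LaurentCF.convDenom (LaurentCF.gSeries (u : ℚ) (v : ℚ)) k).natDegree = k) ∧
    LaurentCF.BadlyApproximable (LaurentCF.gSeries (u : ℚ) (v : ℚ)) := by
  have : Fact p.Prime := ⟨hp⟩
  have h2 : (2 : ZMod p) ≠ 0 := by
    intro h
    have h' : ((2 : ℕ) : ZMod p) = 0 := by exact_mod_cast h
    have := Nat.le_of_dvd (by norm_num) ((ZMod.natCast_eq_zero_iff 2 p).1 h')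
    omega
  have hpar : ∃ s t x y : ZMod p, LaurentCF.IsParameter (u : ZMod p) (v : ZMod p) s t x y := by
    simp only [← ZMod.intCast_eq_intCast_iff] at huv
    push_cast at huv
    rcases huv with ⟨hu, hv⟩ | ⟨hu, hv⟩ | ⟨φ, hφ, hu, hv⟩ | ⟨φ, hφ, hu, hv⟩ |
      ⟨φ, δ, hδ, hφ, hu, hv⟩ | ⟨δ, hδ, hu, hv⟩ | ⟨hp3', δ, hδ, hu, hv⟩
    · rw [hv]
      exact ⟨_, _, _, _, LaurentCF.isParameter_of_sq_eq_three h2 hu⟩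
    · rw [hv]
      exact ⟨_, _, _, _, LaurentCF.isParameter_of_sq_eq_neg_three h2 hu⟩
    · have h := LaurentCF.isParameter_of_right_eq_zero h2 hφ
      rw [hv]
      rcases hu with hu | hu <;> rw [hu]
      exacts [⟨_, _, _, _, h⟩, ⟨_, _, _, _, h.neg⟩]
    · have h := LaurentCF.isParameter_of_pow_four h2 hφ
      rw [hv]
      rcases hu with hu | hu <;> rw [hu]
      exacts [⟨_, _, _, _, h⟩, ⟨_, _, _, _, h.neg⟩]
    · have h := LaurentCF.isParameter_of_sq_eq_two_mul h2 hδ hφ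
      rw [hv]
      rcases hu with hu | hu <;> rw [hu]
      exacts [⟨_, _, _, _, h⟩, ⟨_, _, _, _, h.neg⟩]
    · rw [hu]
      rcases hv with hv | hv <;> rw [hv]
      exacts [⟨_, _, _, _, LaurentCF.isParameter_of_left_eq_zero h2 hδ⟩,
        ⟨_, _, _, _, LaurentCF.isParameter_of_left_eq_zero' h2 hδ⟩]
    · have h3 : (3 : ZMod p) ≠ 0 := by
        intro h
        have h' : ((3 : ℕ) : ZMod p) = 0 := by exact_mod_cast h
        have := Nat.le_of_dvd (by norm_num) ((ZMod.natCast_eq_zero_iff 3 p).1 h')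
        omega
      have h := LaurentCF.isParameter_of_eq_two_mul_sq h2 h3 hδ
      rw [hv]
      rcases hu with hu | hu <;> rw [hu]
      exacts [⟨_, _, _, _, h⟩, ⟨_, _, _, _, h.neg⟩]
  obtain ⟨s, t, x, y, h⟩ := hpar
  have hn := LaurentCF.isNormal_gSeries_of_isSelfSimilar h.isSelfSimilar
  have hdeg : ∀ k : ℕ, 1 ≤ k →
      (LaurentCF.partialQuotient (LaurentCF.gSeries (u : ℚ) (v : ℚ)) k).natDegree = 1 := by
    intro k hk
    obtain ⟨k, rfl⟩ := Nat.exists_eq_add_of_le' hk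
    exact hn.natDegree_partialQuotient k
  -- The bound is 1. The value 0, which marks the end of an expansion, has `natDegree` 0 and is thus
  -- excluded by degree one.
  refine ⟨hdeg, hn.natDegree_convDenom, 1, fun k hk => ⟨fun e => ?_, (hdeg k hk).le⟩⟩
  have := hdeg k hk
  rw [e, natDegree_zero] at this
  exact zero_ne_one this
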